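/- Let $\varphi_r(t)=e^{t^r}-1$ and, for a random variable $f$ on a probability space $(\Omega,\mathcal A,\mathbb P)$, let $\|f\|_{L_{\varphi_r}}=\inf\{\varepsilon>0:\int\varphi_r(|f|/\varepsilon)\,d\mathbb P\le 1\}$ (with $\inf\emptyset=\infty$). Let $\mathbb K$ be $\mathbb R$ or $\mathbb C$. A $\mathbb K$-valued random variable $\gamma$ is subgaussian if for some $\sigma\ge 0$ one has $\mathbb E\exp(\mathrm{Re}(z\gamma))\le\exp(\sigma^2|z|^2/2)$ for all $z\in\mathbb K$; the least such $\sigma$ is denoted $\mathrm{sg}(\gamma)$. A trigonometric polynomial of degree at most $m$ on the torus $\mathbb T^n$ is a function $P(z)=\sum_{\alpha\in\mathbb Z^n,\ |\alpha|\le m}c_\alpha z^\alpha$ with $c_\alpha\in\mathbb C$, where $|\alpha|=|\alpha_1|+\dots+|\alpha_n|$. For $x\in\mathbb C^K$ and $1<p<\infty$ put $\|x\|_{\ell_{p,\infty}}=\sup_{1\le k\le K}k^{1/p}x_k^*$, where $x_1^*\ge x_2^*\ge\dots\ge x_K^*$ is the decreasing rearrangement of $(|x_i|)_{i=1}^K$.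 **Theorem.** (1) For every $s$ there is a constant $C_2=C(s)>0$ such that for all integers $n,m\ge 1$ and $K\ge0$, all independent subgaussian (all real or all complex) random variables $\gamma_1,\dots,\gamma_K$ on a probability space with $\mathrm{sg}(\gamma_i)\le s$ for all $i$, and all trigonometric polynomials $P_1,\dots,P_K$ on $\mathbb T^n$ of degree at most $m$, $$\Big\|\sup_{z\in\mathbb T^n}\Big|\sum_{i=1}^K\gamma_iP_i(z)\Big|\Big\|_{L_{\varphi_2}}\le C_2\,\big(n(1+\log m)\big)^{1/2}\sup_{z\in\mathbb T^n}\big\|(P_i(z))_{i=1}^K\big\|_{\ell_2}.$$ (2) For every $r\in(2,\infty)$ and all $s,M$ there is a constant $C_r=C(r,s,M)>0$ such that for all $n,m,K$, $\gamma_i$, $P_i$ as in (1) which satisfy in addition $\|\gamma_i\|_\infty\le M$ for all $i$, $$\Big\|\sup_{z\in\mathbb T^n}\Big|\sum_{i=1}^K\gamma_iP_i(z)\Big|\Big\|_{L_{\varphi_r}}\le C_r\,\big(n(1+\log m)\big)^{1/r}\sup_{z\in\mathbb T^n}\big\|(P_i(z))_{i=1}^K\big\|_{\ell_{r',\infty}},\qquad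 \tfrac1r+\tfrac1{r'}=1.$$ -/

import Mathlib

open MeasureTheory ProbabilityTheory
open scoped ENNReal

noncomputable section

namespace KSZ

/-- The exponential Orlicz function `φ_r(t) = exp(t ^ r) - 1`. -/
def expOrlicz (r t : ℝ) : ℝ := Real.exp (t ^ r) - 1

/-- The Luxemburg norm `inf {ε > 0 : ∫ φ(|f| / ε) dP ≤ 1}`, with value `∞` if there is no such
`ε`. -/
def orliczNorm {Ω : Type*} [MeasurableSpace Ω] (P : Measure Ω) (φ : ℝ → ℝ) (f : Ω → ℝ) : ℝ≥0∞ :=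
  ⨅ (ε : ℝ) (_ : 0 < ε) (_ : ∫⁻ ω, ENNReal.ofReal (φ (|f ω| / ε)) ∂P ≤ 1), ENNReal.ofReal ε

/-- `f` satisfies `E exp(Re(z f)) ≤ exp(s² |z|² / 2)` for all scalars `z`. For `𝕜 = ℝ` the real
part is the identity. -/
def SubgaussianBound {𝕜 : Type*} [RCLike 𝕜] {Ω : Type*} [MeasurableSpace Ω] (P : Measure Ω)
    (f : Ω → 𝕜) (s : ℝ) : Prop :=
  ∀ z : 𝕜, ∫⁻ ω, ENNReal.ofReal (Real.exp (RCLike.re (z * f ω))) ∂P ≤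
    ENNReal.ofReal (Real.exp (s ^ 2 * ‖z‖ ^ 2 / 2))

/-- `f` is a (real or complex) subgaussian random variable. -/
def IsSubgaussian {𝕜 : Type*} [RCLike 𝕜] {Ω : Type*} [MeasurableSpace Ω] (P : Measure Ω)
    (f : Ω → 𝕜) : Prop :=
  Measurable f ∧ ∃ s : ℝ, 0 ≤ s ∧ SubgaussianBound P f s

/-- The best subgaussian constant of a subgaussian random variable. -/
def sg {𝕜 : Type*} [RCLike 𝕜] {Ω : Type*} [MeasurableSpace Ω] (P : Measure Ω)
    (f : Ω → 𝕜) : ℝ :=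
  sInf {s : ℝ | 0 ≤ s ∧ SubgaussianBound P f s}

/-- `F` is a trigonometric polynomial on the `n`-dimensional torus of degree at most `m`:
a finite sum of `c α * z ^ α` over `α ∈ ℤⁿ` with `|α₁| + ⋯ + |αₙ| ≤ m`. -/
def IsTrigPoly {n : ℕ} (m : ℕ) (F : (Fin n → Circle) → ℂ) : Prop :=
  ∃ c : (Fin n → ℤ) →₀ ℂ, (∀ α ∈ c.support, ∑ j, (α j).natAbs ≤ m) ∧
    ∀ z : Fin n → Circle, F z = ∑ α ∈ c.support, c α * ∏ j, (z j : ℂ) ^ α j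

/-- The norm of `ℓ₂` on finite sequences. -/
def l2Norm {K : ℕ} (x : Fin K → ℂ) : ℝ := √(∑ i, ‖x i‖ ^ 2)

/-- The decreasing rearrangement of `(|x i|)`, numbered from `0`: the value at `k` is the
`(k + 1)`-st largest of the numbers `|x i|`, and `0` for `k ≥ K`. -/
def decRearr {K : ℕ} (x : Fin K → ℂ) (k : ℕ) : ℝ :=
  sInf {t : ℝ | 0 ≤ t ∧ {i : Fin K | t < ‖x i‖}.ncard ≤ k}

/-- The functional `sup_{k ≥ 1} k ^ (1/p) x*_k` of the Marcinkiewicz space `ℓ_{p,∞}`, on finite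
sequences. -/
def weakNorm {K : ℕ} (p : ℝ) (x : Fin K → ℂ) : ℝ :=
  ⨆ k : ℕ, ((k : ℝ) + 1) ^ (1 / p) * decRearr x k

/-- The random variable `ω ↦ sup_{z} |∑ i, γ i ω * F i z|` on the torus; real and complex scalars
are viewed in `ℂ` through the canonical map. -/
def randomSup {𝕜 : Type*} [RCLike 𝕜] {Ω : Type*} {n K : ℕ} (γ : Fin K → Ω → 𝕜)
    (F : Fin K → (Fin n → Circle) → ℂ) (ω : Ω) : ℝ :=
  ⨆ z : Fin n → Circle, ‖∑ i, RCLike.map 𝕜 ℂ (γ i ω) * F i z‖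

end KSZ

end

/-! The proof is a moment method. If `F` has degree at most `m`, then `F ^ q` has degree at most `q
* m`, and a kernel that reproduces it from its values on a finite grid bounds `‖F z‖ ^ q` by the
grid average of `‖F‖ ^ q` times the number of exponents `|α| ≤ q * m`. That number is at most `e ^ q
* (4 * m) ^ n`, hence at most `e ^ (3 * q)` once `q ≥ X := n * (1 + log m)`. For such `q` the
supremum over the torus costs only the factor `e ^ 3` in the `L_q` norm (`exists_grid_norm_pow_le`,
`grid_constant_le`).

It remains to bound moments at a fixed point by `(T * q ^ (1 / r)) ^ q`. For `r = 2` this is the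
growth of subgaussian moments (`lintegral_norm_sum_pow_le`). For `r > 2` the `q` largest
coefficients are summed using `‖γ i‖ ≤ M`, and the others are handled by the `ℓ₂` bound; both pieces
have order `q ^ (1 / r)` (`lintegral_norm_sum_pow_le_of_weakNorm_le`).

Finally, moments of order `q ^ (1 / r)`, known only for `q ≥ X`, give an Orlicz norm of order `X ^
(1 / r)`: the exponential series is compared term by term with moments of larger order
(`orliczNorm_expOrlicz_le`). -/

namespace KSZ

/-! ### Characters and trigonometric polynomials. -/

/-- The character `z ↦ z ^ α` of the torus. -/
noncomputable def torusChar {n : ℕ} (α : Fin n → ℤ) (z : Fin n → Circle) : ℂ :=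
  ∏ j, (z j : ℂ) ^ α j

lemma norm_torusChar {n : ℕ} (α : Fin n → ℤ) (z : Fin n → Circle) : ‖torusChar α z‖ = 1 := by
  simp only [torusChar, norm_prod, norm_zpow, Circle.norm_coe, one_zpow, Finset.prod_const_one]

lemma torusChar_add {n : ℕ} (α β : Fin n → ℤ) :
    torusChar (α + β) = torusChar α * torusChar β := by
  ext z
  simp only [torusChar, Pi.add_apply, Pi.mul_apply, ← Finset.prod_mul_distrib]
  exact Finset.prod_congr rfl fun j _ => zpow_add₀ (Circle.coe_ne_zero _) _ _

/-- The space of trigonometric polynomials of degree at most `m`. -/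
noncomputable def trigSpace (n m : ℕ) : Submodule ℂ ((Fin n → Circle) → ℂ) :=
  Submodule.span ℂ {f | ∃ α : Fin n → ℤ, ∑ j, (α j).natAbs ≤ m ∧ torusChar α = f}

lemma IsTrigPoly.mem_trigSpace {n m : ℕ} {F : (Fin n → Circle) → ℂ} (hF : IsTrigPoly m F) :
    F ∈ trigSpace n m := by
  obtain ⟨c, hc, hF⟩ := hF
  have : F = ∑ α ∈ c.support, c α • torusChar α := by
    ext z
    simp [hF z, Finset.sum_apply, torusChar]
  rw [this]
  exact Submodule.sum_mem _ fun α hα =>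
    Submodule.smul_mem _ _ (Submodule.subset_span ⟨α, hc α hα, rfl⟩)

lemma norm_le_of_mem_trigSpace {n m : ℕ} {F : (Fin n → Circle) → ℂ} (hF : F ∈ trigSpace n m) :
    ∃ C : ℝ, ∀ z, ‖F z‖ ≤ C := by
  induction hF using Submodule.span_induction with
  | mem f hf =>
    obtain ⟨α, -, rfl⟩ := hf
    exact ⟨1, fun z => (norm_torusChar α z).le⟩
  | zero => exact ⟨0, by simp⟩
  | add f g _ _ hf hg =>
    obtain ⟨C, hC⟩ := hf
    obtain ⟨D, hD⟩ := hg
    exact ⟨C + D, fun z => (norm_add_le _ _).trans (add_le_add (hC z) (hD z))⟩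
  | smul a f _ hf =>
    obtain ⟨C, hC⟩ := hf
    exact ⟨‖a‖ * C, fun z => by
      simpa using mul_le_mul_of_nonneg_left (hC z) (norm_nonneg a)⟩

lemma mul_mem_trigSpace {n m m' : ℕ} {F G : (Fin n → Circle) → ℂ} (hF : F ∈ trigSpace n m)
    (hG : G ∈ trigSpace n m') : F * G ∈ trigSpace n (m + m') := by
  have h := Submodule.mul_mem_mul hF hG
  rw [trigSpace, trigSpace, Submodule.span_mul_span] at h
  refine Submodule.span_mono ?_ h
  rintro _ ⟨_, ⟨α, hα, rfl⟩, _, ⟨β, hβ, rfl⟩, rfl⟩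
  refine ⟨α + β, ?_, torusChar_add α β⟩
  calc ∑ j, ((α + β) j).natAbs ≤ ∑ j, ((α j).natAbs + (β j).natAbs) :=
        Finset.sum_le_sum fun j _ => Int.natAbs_add_le _ _
    _ ≤ m + m' := by rw [Finset.sum_add_distrib]; omega

/-- This lets an `L¹` estimate for polynomials of degree `q * m` act as an `L^q` estimate in degree
`m`. -/
lemma pow_mem_trigSpace {n m : ℕ} {F : (Fin n → Circle) → ℂ} (hF : F ∈ trigSpace n m) (q : ℕ) :
    F ^ q ∈ trigSpace n (q * m) := by
  induction q with
  | zero =>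
    refine Submodule.subset_span ⟨0, by simp, ?_⟩
    ext z
    simp [torusChar]
  | succ q ih =>
    rw [pow_succ, Nat.succ_mul]
    exact mul_mem_trigSpace ih hF

/-! ### Discretization on grids of roots of unity. -/

/-- The primitive `N`-th root of unity `exp (2 π i / N)` as a point of the circle. -/
noncomputable def circleRoot (N : ℕ) : Circle := Circle.exp (2 * Real.pi / N)

lemma isPrimitiveRoot_circleRoot {N : ℕ} (hN : N ≠ 0) :
    IsPrimitiveRoot (circleRoot N : ℂ) N := by
  have h := Complex.isPrimitiveRoot_exp N hN
  convert h using 1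
  rw [circleRoot, Circle.coe_exp]
  congr 1
  push_cast
  ring

/-- A geometric sum: `|d| < N` excludes the nonzero multiples of `N`, so the ratio is `1` only for
`d = 0`. -/
lemma sum_circleRoot_zpow {N : ℕ} (hN : N ≠ 0) (d : ℤ) (hd : d.natAbs < N) :
    ∑ k : Fin N, ((circleRoot N ^ (k : ℕ) : Circle) : ℂ) ^ d = if d = 0 then (N : ℂ) else 0 := by
  split_ifs with h
  · simp [h]
  · have hζ := isPrimitiveRoot_circleRoot hN
    have h1 : (circleRoot N : ℂ) ^ d ≠ 1 := by
      rw [Ne, hζ.zpow_eq_one_iff_dvd]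
      intro h2
      exact h (Int.eq_zero_of_dvd_of_natAbs_lt_natAbs h2 (by simpa using hd))
    have h2 : ∀ k : Fin N, ((circleRoot N ^ (k : ℕ) : Circle) : ℂ) ^ d =
        ((circleRoot N : ℂ) ^ d) ^ (k : ℕ) := fun k => by
      rw [Circle.coe_pow, ← zpow_natCast, ← zpow_natCast, ← zpow_mul, ← zpow_mul, mul_comm]
    simp only [h2]
    rw [Fin.sum_univ_eq_sum_range (fun k => ((circleRoot N : ℂ) ^ d) ^ k), geom_sum_eq h1]
    rw [← zpow_natCast, ← zpow_mul, mul_comm, zpow_mul, zpow_natCast, hζ.pow_eq_one]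
    simp

/-- The grid of `N`-th roots of unity in the torus. -/
noncomputable def torusGrid (n N : ℕ) (k : Fin n → Fin N) : Fin n → Circle :=
  fun j => circleRoot N ^ (k j : ℕ)

lemma sum_torusChar_torusGrid {n N : ℕ} (hN : N ≠ 0) (δ : Fin n → ℤ)
    (hδ : ∀ j, (δ j).natAbs < N) :
    ∑ k, torusChar δ (torusGrid n N k) = if δ = 0 then (N : ℂ) ^ n else 0 := by
  simp only [torusChar, torusGrid]
  rw [← Fintype.piFinset_univ, ← Finset.prod_univ_sum (fun _ => Finset.univ)
    (fun j (k : Fin N) => ((circleRoot N ^ (k : ℕ) : Circle) : ℂ) ^ δ j)]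
  simp only [sum_circleRoot_zpow hN _ (hδ _)]
  split_ifs with h
  · simp [h]
  · obtain ⟨j, hj⟩ := Function.ne_iff.mp h
    exact Finset.prod_eq_zero (Finset.mem_univ j) (if_neg hj)

/-- The exponents `α ∈ ℤⁿ` with `|α| ≤ d`. -/
noncomputable def degBall (n d : ℕ) : Finset (Fin n → ℤ) :=
  (Fintype.piFinset fun _ => Finset.Icc (-d : ℤ) d).filter fun α => ∑ j, (α j).natAbs ≤ d

lemma mem_degBall {n d : ℕ} {α : Fin n → ℤ} : α ∈ degBall n d ↔ ∑ j, (α j).natAbs ≤ d := by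
  simp only [degBall, Finset.mem_filter, Fintype.mem_piFinset, Finset.mem_Icc,
    and_iff_right_iff_imp]
  intro h j
  have := (Finset.single_le_sum (f := fun j => (α j).natAbs) (fun _ _ => Nat.zero_le _)
    (Finset.mem_univ j)).trans h
  omega

/-- The Dirichlet kernel of the degree ball reproduces `F` by discrete orthogonality. The
frequencies that occur are differences of two exponents, with coordinates at most `2 * d` in
absolute value, so `2 * d < N` prevents aliasing. -/
lemma sum_torusGrid_mul_kernel {n d N : ℕ} (hN : 2 * d < N) {F : (Fin n → Circle) → ℂ}
    (hF : F ∈ trigSpace n d) (z : Fin n → Circle) :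
    ∑ k, F (torusGrid n N k) *
      ∑ α ∈ degBall n d, torusChar α z * torusChar (-α) (torusGrid n N k) = (N : ℂ) ^ n * F z := by
  have hN0 : N ≠ 0 := by omega
  induction hF using Submodule.span_induction with
  | mem f hf =>
    obtain ⟨β, hβ, rfl⟩ := hf
    have hδ : ∀ α ∈ degBall n d, ∀ j, ((β + -α) j).natAbs < N := fun α hα j => by
      have h1 := (Finset.single_le_sum (f := fun j => (α j).natAbs) (fun _ _ => Nat.zero_le _)
        (Finset.mem_univ j)).trans (mem_degBall.mp hα)
      have h2 := (Finset.single_le_sum (f := fun j => (β j).natAbs) (fun _ _ => Nat.zero_le _)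
        (Finset.mem_univ j)).trans hβ
      simp only [Pi.add_apply, Pi.neg_apply] at h1 h2 ⊢
      omega
    calc _ = ∑ α ∈ degBall n d, torusChar α z * ∑ k, torusChar (β + -α) (torusGrid n N k) := by
          simp only [Finset.mul_sum]
          rw [Finset.sum_comm]
          refine Finset.sum_congr rfl fun α _ => Finset.sum_congr rfl fun k _ => ?_
          rw [torusChar_add, Pi.mul_apply]
          ring
      _ = ∑ α ∈ degBall n d, if α = β then (N : ℂ) ^ n * torusChar β z else 0 := by
          refine Finset.sum_congr rfl fun α hα => ?_
          rw [sum_torusChar_torusGrid hN0 _ (hδ α hα)]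
          have : β + -α = 0 ↔ α = β := by rw [← sub_eq_add_neg, sub_eq_zero, eq_comm]
          by_cases h : α = β
          · rw [if_pos (this.mpr h), if_pos h, h, mul_comm]
          · rw [if_neg (mt this.mp h), if_neg h, mul_zero]
      _ = _ := by rw [Finset.sum_ite_eq', if_pos (mem_degBall.mpr hβ)]
  | zero => simp
  | add f g _ _ hf hg =>
    simp only [Pi.add_apply, add_mul, Finset.sum_add_distrib, hf, hg, mul_add]
  | smul a f _ hf =>
    simp only [Pi.smul_apply, smul_eq_mul, mul_assoc]
    rw [← Finset.mul_sum, hf]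
    ring

/-- The kernel is bounded trivially by its number of characters. -/
lemma norm_le_card_mul_average {n d N : ℕ} (hN : 2 * d < N) {F : (Fin n → Circle) → ℂ}
    (hF : F ∈ trigSpace n d) (z : Fin n → Circle) :
    ‖F z‖ ≤ (degBall n d).card * (((N : ℝ) ^ n)⁻¹ * ∑ k, ‖F (torusGrid n N k)‖) := by
  have hN0 : (0 : ℝ) < (N : ℝ) ^ n := pow_pos (by exact_mod_cast (by omega : 0 < N)) n
  have h := congrArg norm (sum_torusGrid_mul_kernel hN hF z)
  rw [norm_mul, norm_pow, Complex.norm_natCast] at h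
  have h2 : (N : ℝ) ^ n * ‖F z‖ ≤ ∑ k, ‖F (torusGrid n N k)‖ * (degBall n d).card := by
    rw [← h]
    refine (norm_sum_le _ _).trans (Finset.sum_le_sum fun k _ => ?_)
    rw [norm_mul]
    refine mul_le_mul_of_nonneg_left ((norm_sum_le _ _).trans ?_) (norm_nonneg _)
    simp [norm_torusChar]
  rw [← Finset.sum_mul] at h2
  calc ‖F z‖ = ((N : ℝ) ^ n)⁻¹ * ((N : ℝ) ^ n * ‖F z‖) := by field_simp
    _ ≤ ((N : ℝ) ^ n)⁻¹ * ((∑ k, ‖F (torusGrid n N k)‖) * (degBall n d).card) := by gcongr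
    _ = _ := by ring

lemma sum_Icc_pow_natAbs_le {x : ℝ} (h0 : 0 ≤ x) (h1 : x < 1) (d : ℕ) :
    ∑ a ∈ Finset.Icc (-d : ℤ) d, x ^ a.natAbs ≤ 2 / (1 - x) := by
  have hgeo : ∑ k ∈ Finset.range (d + 1), x ^ k ≤ 1 / (1 - x) := by
    rw [geom_sum_eq h1.ne, ← neg_div_neg_eq, neg_sub, neg_sub]
    have := pow_nonneg h0 (d + 1)
    have : 0 < 1 - x := by linarith
    gcongr
    linarith
  have hsub : Finset.Icc (-d : ℤ) d ⊆ (Finset.range (d + 1)).image (fun k : ℕ => (k : ℤ)) ∪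
      (Finset.range (d + 1)).image (fun k : ℕ => -(k : ℤ)) := by
    intro a ha
    rw [Finset.mem_Icc] at ha
    simp only [Finset.mem_union, Finset.mem_image, Finset.mem_range]
    rcases le_total 0 a with h | h
    · exact Or.inl ⟨a.natAbs, by omega, by omega⟩
    · exact Or.inr ⟨a.natAbs, by omega, by omega⟩
  calc ∑ a ∈ Finset.Icc (-d : ℤ) d, x ^ a.natAbs
      ≤ _ := Finset.sum_le_sum_of_subset_of_nonneg hsub fun _ _ _ => pow_nonneg h0 _
    _ ≤ _ := (le_of_le_of_eq (le_add_of_nonneg_right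
          (Finset.sum_nonneg fun _ _ => pow_nonneg h0 _)) (Finset.sum_union_inter))
    _ = ∑ k ∈ Finset.range (d + 1), x ^ k + ∑ k ∈ Finset.range (d + 1), x ^ k := by
        rw [Finset.sum_image fun _ _ _ _ h => by simpa using h,
          Finset.sum_image fun _ _ _ _ h => by simpa using h]
        simp
    _ ≤ _ := by
        rw [show 2 / (1 - x) = 1 / (1 - x) + 1 / (1 - x) by ring]
        exact add_le_add hgeo hgeo

/-- Rankin's trick: with `x = exp (-1 / m)`, each exponent in the ball satisfies `x ^ (q * m) ≤ x ^
|α|`, and the sum of `x ^ |α|` over the surrounding box factorizes into `n` sums, each at most `2 /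
(1 - x) ≤ 4 * m`. The factor `e ^ q` is `x ^ (-q * m)`. -/
lemma card_degBall_le {m : ℕ} (hm : 1 ≤ m) (n q : ℕ) :
    ((degBall n (q * m)).card : ℝ) ≤ Real.exp q * (4 * m) ^ n := by
  have hm' : (1 : ℝ) ≤ m := by exact_mod_cast hm
  set x := Real.exp (-(1 / (m : ℝ))) with hx
  have hx0 : 0 < x := Real.exp_pos _
  have hx1 : 1 / (2 * (m : ℝ)) ≤ 1 - x := by
    have h1 : 1 + 1 / (m : ℝ) ≤ Real.exp (1 / m) := by
      have := Real.add_one_le_exp (1 / (m : ℝ)); linarith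
    have h2 : x ≤ 1 / (1 + 1 / (m : ℝ)) := by
      rw [hx, Real.exp_neg, ← one_div]
      exact one_div_le_one_div_of_le (by positivity) h1
    have h3 : 1 - 1 / (1 + 1 / (m : ℝ)) = 1 / (m + 1) := by
      field_simp
      ring
    have h4 : 1 / (2 * (m : ℝ)) ≤ 1 / (m + 1) :=
      one_div_le_one_div_of_le (by positivity) (by linarith)
    linarith
  have hx2 : 0 < 1 - x := lt_of_lt_of_le (by positivity) hx1
  have hxm : x ^ (q * m) = Real.exp (-(q : ℝ)) := by
    rw [hx, ← Real.exp_nat_mul]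
    congr 1
    push_cast
    field_simp
  have hsum : ∑ a ∈ Finset.Icc (-(q * m : ℕ) : ℤ) (q * m : ℕ), x ^ a.natAbs ≤ 4 * m := by
    refine (sum_Icc_pow_natAbs_le hx0.le (by linarith) _).trans ?_
    rw [div_le_iff₀ hx2]
    calc (2 : ℝ) = 4 * m * (1 / (2 * m)) := by field_simp; norm_num
      _ ≤ _ := by gcongr
  have hle : ((degBall n (q * m)).card : ℝ) * x ^ (q * m) ≤ (4 * m) ^ n := by
    calc ((degBall n (q * m)).card : ℝ) * x ^ (q * m)
        = ∑ α ∈ degBall n (q * m), x ^ (q * m) := by simp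
      _ ≤ ∑ α ∈ degBall n (q * m), ∏ j, x ^ (α j).natAbs := by
          refine Finset.sum_le_sum fun α hα => ?_
          rw [Finset.prod_pow_eq_pow_sum]
          exact pow_le_pow_of_le_one hx0.le (by linarith) (mem_degBall.mp hα)
      _ ≤ ∑ α ∈ Fintype.piFinset fun _ : Fin n => Finset.Icc (-(q * m : ℕ) : ℤ) (q * m : ℕ),
            ∏ j, x ^ (α j).natAbs :=
          Finset.sum_le_sum_of_subset_of_nonneg (Finset.filter_subset _ _)
            fun _ _ _ => Finset.prod_nonneg fun _ _ => pow_nonneg hx0.le _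
      _ = (∑ a ∈ Finset.Icc (-(q * m : ℕ) : ℤ) (q * m : ℕ), x ^ a.natAbs) ^ n := by
          rw [← Finset.prod_univ_sum (fun _ : Fin n => Finset.Icc (-(q * m : ℕ) : ℤ) (q * m : ℕ))
            (fun _ a => x ^ a.natAbs)]
          simp
      _ ≤ _ := pow_le_pow_left₀ (Finset.sum_nonneg fun _ _ => pow_nonneg hx0.le _) hsum n
  rw [hxm, Real.exp_neg, ← div_eq_mul_inv, div_le_iff₀ (Real.exp_pos _)] at hle
  linarith

/-- A trigonometric polynomial of degree at most `m` is controlled by its `q`-th moment over a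
finite subset of the torus. -/
theorem exists_grid_norm_pow_le {m : ℕ} (hm : 1 ≤ m) (n q : ℕ) :
    ∃ N : ℕ, 0 < N ∧ ∀ F ∈ trigSpace n m, ∀ z, ‖F z‖ ^ q ≤
      Real.exp q * (4 * m) ^ n * (((N : ℝ) ^ n)⁻¹ * ∑ k, ‖F (torusGrid n N k)‖ ^ q) := by
  -- The least size without aliasing for `F ^ q`, whose degree is at most `q * m`.
  refine ⟨2 * (q * m) + 1, by omega, fun F hF z => ?_⟩
  have h := norm_le_card_mul_average (N := 2 * (q * m) + 1) (by omega) (pow_mem_trigSpace hF q) z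
  simp only [Pi.pow_apply, norm_pow] at h
  refine h.trans (mul_le_mul_of_nonneg_right (card_degBall_le hm n q) ?_)
  positivity

/-! ### From moments to exponential Orlicz norms. -/

/-- Rescale by `S = T * q ^ (1 / r)`, the bound for the `q`-th moment norm. As `r * j ≤ q`, the
power `r * j` of `z / S` is at most `1 + (z / S) ^ q`. The constant `16 * e * r` makes `(S / ε) ^ r
≤ j / (4 * e)`, and `j ^ j / j! ≤ e ^ j` then leaves `(1 / 4) ^ j`. -/
lemma exp_term_le_of_moment_scale {r X T z : ℝ} (hr : 1 ≤ r) (hX : 1 ≤ X) (hT : 0 < T)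
    (hz : 0 ≤ z) (j : ℕ) (hj : 1 ≤ j) {q : ℕ} (hq0 : 0 < q) (hq1 : r * j ≤ q)
    (hq2 : (q : ℝ) ≤ 4 * (r * j) * X) :
    ((z / ((16 * Real.exp 1 * r) ^ (1 / r) * X ^ (1 / r) * T)) ^ r) ^ j / (j.factorial : ℝ) ≤
      (1 / 4) ^ j * (1 + z ^ q / (T * (q : ℝ) ^ (1 / r)) ^ q) := by
  have hr0 : 0 < r := by linarith
  have hX0 : 0 < X := by linarith
  have hq0' : (0 : ℝ) < q := by exact_mod_cast hq0
  have hj0 : (0 : ℝ) < j := by exact_mod_cast hj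
  have he := Real.exp_pos 1
  set S := T * (q : ℝ) ^ (1 / r) with hS
  have hS0 : 0 < S := by positivity
  set ε := (16 * Real.exp 1 * r) ^ (1 / r) * X ^ (1 / r) * T with hε
  have hε0 : 0 < ε := by positivity
  have hroot : ∀ a : ℝ, 0 ≤ a → (a ^ (1 / r)) ^ r = a := fun a ha => by
    rw [← Real.rpow_mul ha, one_div_mul_cancel hr0.ne', Real.rpow_one]
  have h1 : (S / ε) ^ r = q / (16 * Real.exp 1 * r * X) := by
    rw [Real.div_rpow hS0.le hε0.le, hS, hε, Real.mul_rpow hT.le (by positivity),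
      Real.mul_rpow (by positivity) hT.le, Real.mul_rpow (by positivity) (by positivity),
      hroot _ hq0'.le, hroot _ (by positivity), hroot _ hX0.le]
    have : 0 < T ^ r := by positivity
    field_simp
  have h2 : (S / ε) ^ r ≤ j / (4 * Real.exp 1) := by
    rw [h1, div_le_div_iff₀ (by positivity) (by positivity)]
    calc (q : ℝ) * (4 * Real.exp 1) ≤ (4 * (r * j) * X) * (4 * Real.exp 1) := by gcongr
      _ = _ := by ring
  have h3 : ((S / ε) ^ r) ^ j / (j.factorial : ℝ) ≤ (1 / 4) ^ j := by
    have h4 := Real.pow_div_factorial_le_exp (x := (j : ℝ)) hj0.le j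
    calc ((S / ε) ^ r) ^ j / (j.factorial : ℝ)
        ≤ (j / (4 * Real.exp 1)) ^ j / (j.factorial : ℝ) := by gcongr
      _ = ((j : ℝ) ^ j / j.factorial) * (1 / (4 * Real.exp 1)) ^ j := by
          rw [div_pow, div_pow, one_pow]; ring
      _ ≤ Real.exp j * (1 / (4 * Real.exp 1)) ^ j := by gcongr
      _ = (1 / 4) ^ j := by
          rw [← Real.exp_one_pow j, ← mul_pow]
          congr 1
          field_simp
  have h5 : ((z / S) ^ r) ^ j ≤ 1 + (z / S) ^ q := by
    have hzS : 0 ≤ z / S := by positivity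
    rw [← Real.rpow_natCast ((z / S) ^ r) j, ← Real.rpow_mul hzS]
    rcases le_total (z / S) 1 with h | h
    · have := Real.rpow_le_one hzS h (by positivity : 0 ≤ r * j)
      have := pow_nonneg hzS q
      linarith
    · have := Real.rpow_le_rpow_of_exponent_le h hq1
      rw [Real.rpow_natCast] at this
      linarith
  have h6 : z / ε = (z / S) * (S / ε) := by field_simp
  rw [h6, Real.mul_rpow (by positivity) (by positivity), mul_pow, mul_div_assoc, ← div_pow,
    mul_comm]
  exact mul_le_mul h3 h5 (by positivity) (by positivity)

/-- Moment bounds of order `q ^ (1 / r)` for all `q ≥ X` give a bound of order `X ^ (1 / r)` for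
the exponential Orlicz norm. -/
theorem orliczNorm_expOrlicz_le {Ω : Type*} [MeasurableSpace Ω] {P : Measure Ω}
    [IsProbabilityMeasure P] {r X T : ℝ} (hr : 1 ≤ r) (hX : 1 ≤ X) (hT : 0 < T) {Z : Ω → ℝ}
    (hZ : ∀ ω, 0 ≤ Z ω)
    (h : ∀ q : ℕ, X ≤ q → ∃ Y : Ω → ℝ≥0∞, Measurable Y ∧
      (∀ ω, ENNReal.ofReal (Z ω ^ q) ≤ Y ω) ∧
      ∫⁻ ω, Y ω ∂P ≤ ENNReal.ofReal ((T * (q : ℝ) ^ (1 / r)) ^ q)) :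
    orliczNorm P (expOrlicz r) Z ≤
      ENNReal.ofReal ((16 * Real.exp 1 * r) ^ (1 / r) * X ^ (1 / r) * T) := by
  have hr0 : 0 < r := by linarith
  have hX0 : 0 < X := by linarith
  set ε := (16 * Real.exp 1 * r) ^ (1 / r) * X ^ (1 / r) * T with hε
  have hε0 : 0 < ε := by
    have := Real.exp_pos 1
    positivity
  refine iInf₂_le_of_le ε hε0 (iInf_le_of_le ?_ le_rfl)
  -- An integer above both `r * (k + 1)` and `X`, at most `4 * r * (k + 1) * X` since rounding up a
  -- number `≥ 1` at most doubles it. The excess factor `X` is what `X ^ (1 / r)` in `ε` absorbs.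
  set q : ℕ → ℕ := fun k => ⌈r * (k + 1 : ℕ)⌉₊ * ⌈X⌉₊ with hq
  have hrk : ∀ k : ℕ, 1 ≤ r * (k + 1 : ℕ) := fun k => by
    have : (1 : ℝ) ≤ (k + 1 : ℕ) := by exact_mod_cast Nat.le_add_left 1 k
    nlinarith
  have hc1 : ∀ k : ℕ, (1 : ℝ) ≤ ⌈r * (k + 1 : ℕ)⌉₊ := fun k => (hrk k).trans (Nat.le_ceil _)
  have hc2 : (1 : ℝ) ≤ ⌈X⌉₊ := hX.trans (Nat.le_ceil _)
  have hq1 : ∀ k, r * (k + 1 : ℕ) ≤ q k := fun k => by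
    have := Nat.le_ceil (r * (k + 1 : ℕ))
    simp only [hq]
    push_cast at this ⊢
    have h1 := hc1 k
    push_cast at h1
    nlinarith
  have hqX : ∀ k, X ≤ q k := fun k => by
    have := Nat.le_ceil X
    have h1 := hc1 k
    simp only [hq]
    push_cast at h1 ⊢
    nlinarith
  have hq2 : ∀ k, (q k : ℝ) ≤ 4 * (r * (k + 1 : ℕ)) * X := fun k => by
    have h1 := (Nat.ceil_lt_add_one (by linarith [hrk k] : 0 ≤ r * (k + 1 : ℕ))).le
    have h2 := (Nat.ceil_lt_add_one hX0.le).le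
    have h3 : (⌈r * (k + 1 : ℕ)⌉₊ : ℝ) ≤ 2 * (r * (k + 1 : ℕ)) := by linarith [hrk k]
    have h4 : (⌈X⌉₊ : ℝ) ≤ 2 * X := by linarith
    calc (q k : ℝ) = (⌈r * (k + 1 : ℕ)⌉₊ : ℝ) * ⌈X⌉₊ := by simp only [hq]; push_cast; rfl
      _ ≤ (2 * (r * (k + 1 : ℕ))) * (2 * X) := by
          have := hrk k
          gcongr
      _ = _ := by ring
  have hq0 : ∀ k, 0 < q k := fun k => by
    have := hX.trans (hqX k)
    exact_mod_cast (by linarith : (0 : ℝ) < q k)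
  choose Y hYm hZY hY using fun k => h (q k) (hqX k)
  set c : ℕ → ℝ := fun k => (T * (q k : ℝ) ^ (1 / r)) ^ q k with hc
  have hcpos : ∀ k, 0 < c k := fun k => by
    have : (0 : ℝ) < q k := by exact_mod_cast hq0 k
    simp only [hc]
    positivity
  -- Built from the measurable majorants `Y k`, so that sum and integral can be interchanged without
  -- measurability of `Z`.
  set W : ℕ → Ω → ℝ≥0∞ := fun k ω =>
    ENNReal.ofReal ((1 / 4) ^ (k + 1)) * (1 + ENNReal.ofReal (c k)⁻¹ * Y k ω) with hW
  have hpt : ∀ ω, ENNReal.ofReal (expOrlicz r (|Z ω| / ε)) ≤ ∑' k, W k ω := by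
    intro ω
    set u := (Z ω / ε) ^ r with hu
    have hu0 : 0 ≤ u := Real.rpow_nonneg (div_nonneg (hZ ω) hε0.le) r
    have hexp : HasSum (fun k : ℕ => u ^ (k + 1) / ((k + 1).factorial : ℝ)) (Real.exp u - 1) := by
      have h1 : HasSum (fun k : ℕ => u ^ k / (k.factorial : ℝ)) (Real.exp u) := by
        rw [Real.exp_eq_exp_ℝ]
        exact NormedSpace.expSeries_div_hasSum_exp u
      have h2 := (hasSum_nat_add_iff' 1).mpr h1
      simpa using h2
    rw [expOrlicz, abs_of_nonneg (hZ ω), ← hexp.tsum_eq,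
      ENNReal.ofReal_tsum_of_nonneg (fun k => by positivity) hexp.summable]
    refine ENNReal.tsum_le_tsum fun k => ?_
    refine (ENNReal.ofReal_le_ofReal (exp_term_le_of_moment_scale hr hX hT (hZ ω) (k + 1)
      (by omega) (hq0 k) (hq1 k) (hq2 k))).trans ?_
    have hz := pow_nonneg (hZ ω) (q k)
    rw [ENNReal.ofReal_mul (by positivity), ENNReal.ofReal_add zero_le_one
      (div_nonneg hz (hcpos k).le), ENNReal.ofReal_one, div_eq_inv_mul (Z ω ^ q k),
      ENNReal.ofReal_mul (inv_nonneg.mpr (hcpos k).le)]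
    simp only [hW]
    gcongr
    exact hZY k ω
  have hWm : ∀ k, Measurable (W k) := fun k =>
    (measurable_const.fun_add ((hYm k).const_mul _)).const_mul _
  have hWint : ∀ k, ∫⁻ ω, W k ω ∂P ≤ ENNReal.ofReal (1 / 2 / 2 ^ k) := by
    intro k
    simp only [hW]
    rw [lintegral_const_mul _ (measurable_const.fun_add ((hYm k).const_mul _)),
      lintegral_add_left measurable_const, lintegral_const_mul _ (hYm k), lintegral_const,
      measure_univ, mul_one]
    calc _ ≤ ENNReal.ofReal ((1 / 4) ^ (k + 1)) *
          (1 + ENNReal.ofReal (c k)⁻¹ * ENNReal.ofReal (c k)) := by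
            gcongr
            exact hY k
      _ = ENNReal.ofReal ((1 / 4) ^ (k + 1) * 2) := by
          rw [← ENNReal.ofReal_mul (inv_nonneg.mpr (hcpos k).le), inv_mul_cancel₀ (hcpos k).ne',
            ENNReal.ofReal_mul (by positivity), ENNReal.ofReal_one]
          norm_num
      _ ≤ _ := by
          refine ENNReal.ofReal_le_ofReal ?_
          have h1 : ((1 : ℝ) / 4) ^ k ≤ (1 / 2) ^ k := by gcongr; norm_num
          have h2 : (1 : ℝ) / 2 / 2 ^ k = 1 / 2 * (1 / 2) ^ k := by
            rw [div_pow, one_pow]; ring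
          rw [h2, pow_succ]
          linarith
  calc ∫⁻ ω, ENNReal.ofReal (expOrlicz r (|Z ω| / ε)) ∂P
      ≤ ∫⁻ ω, ∑' k, W k ω ∂P := lintegral_mono hpt
    _ = ∑' k, ∫⁻ ω, W k ω ∂P := lintegral_tsum fun k => (hWm k).aemeasurable
    _ ≤ ∑' k : ℕ, ENNReal.ofReal (1 / 2 / 2 ^ k) := ENNReal.tsum_le_tsum hWint
    _ = 1 := by
        rw [← ENNReal.ofReal_tsum_of_nonneg (fun k => by positivity) (hasSum_geometric_two' 1).summable,
          (hasSum_geometric_two' 1).tsum_eq, ENNReal.ofReal_one]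

/-! ### Moments of subgaussian variables and of their linear combinations. -/

lemma two_pow_add_pow_le {a b : ℝ} (ha : 0 ≤ a) (hb : 0 ≤ b) (q : ℕ) :
    (a + b) ^ q ≤ 2 ^ q * (a ^ q + b ^ q) := by
  have h : a + b ≤ 2 * max a b := by linarith [le_max_left a b, le_max_right a b]
  calc (a + b) ^ q ≤ (2 * max a b) ^ q := by gcongr
    _ = 2 ^ q * (max a b) ^ q := mul_pow _ _ _
    _ ≤ _ := by
        gcongr
        rcases max_choice a b with h | h <;> rw [h]
        · linarith [pow_nonneg hb q]
        · linarith [pow_nonneg ha q]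

lemma abs_pow_le_exp {l : ℝ} (hl : 0 < l) (t : ℝ) (q : ℕ) :
    |t| ^ q ≤ (q / l) ^ q * (Real.exp (l * t) + Real.exp (-l * t)) := by
  have h1 := Real.pow_div_factorial_le_exp (x := l * |t|) (by positivity) q
  have h2 : Real.exp (l * |t|) ≤ Real.exp (l * t) + Real.exp (-l * t) := by
    rcases abs_choice t with h | h <;> rw [h]
    · linarith [Real.exp_pos (-l * t)]
    · rw [mul_neg, ← neg_mul]
      linarith [Real.exp_pos (l * t)]
  have h3 : (q.factorial : ℝ) ≤ (q : ℝ) ^ q := by exact_mod_cast Nat.factorial_le_pow q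
  rw [div_le_iff₀ (by positivity), mul_pow] at h1
  calc |t| ^ q = (l ^ q * |t| ^ q) / l ^ q := by field_simp
    _ ≤ ((Real.exp (l * t) + Real.exp (-l * t)) * (q : ℝ) ^ q) / l ^ q := by
        refine div_le_div_of_nonneg_right ?_ (by positivity)
        exact h1.trans (mul_le_mul h2 h3 (by positivity) (by positivity))
    _ = _ := by rw [div_pow]; ring

/-- The four multipliers have modulus `l` and extract `± l * re w` and `± l * im w`, so one
exponential moment bound serves all four terms. -/
lemma norm_pow_le_exp {l : ℝ} (hl : 0 < l) (w : ℂ) (q : ℕ) :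
    ‖w‖ ^ q ≤ (2 * (q / l)) ^ q * (Real.exp (((l : ℂ) * w).re) + Real.exp (((-l : ℂ) * w).re) +
      (Real.exp (((-l * Complex.I : ℂ) * w).re) + Real.exp (((l * Complex.I : ℂ) * w).re))) := by
  have h1 := abs_pow_le_exp hl w.re q
  have h2 := abs_pow_le_exp hl w.im q
  have e1 : ((l : ℂ) * w).re = l * w.re := by simp
  have e2 : ((-l : ℂ) * w).re = -l * w.re := by simp
  have e3 : ((-l * Complex.I : ℂ) * w).re = l * w.im := by simp
  have e4 : ((l * Complex.I : ℂ) * w).re = -l * w.im := by simp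
  rw [e1, e2, e3, e4, mul_pow, mul_assoc]
  calc ‖w‖ ^ q ≤ (|w.re| + |w.im|) ^ q := by gcongr; exact Complex.norm_le_abs_re_add_abs_im w
    _ ≤ 2 ^ q * (|w.re| ^ q + |w.im| ^ q) := two_pow_add_pow_le (abs_nonneg _) (abs_nonneg _) q
    _ ≤ _ := by
        gcongr
        rw [mul_add]
        exact add_le_add h1 h2

/-- Moments of a complex random variable with subgaussian exponential moments. -/
theorem lintegral_norm_pow_le_of_exp {Ω : Type*} [MeasurableSpace Ω] {P : Measure Ω}
    {f : Ω → ℂ} (hf : Measurable f) {B : ℝ} (hB : 0 < B)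
    (h : ∀ w : ℂ, ∫⁻ ω, ENNReal.ofReal (Real.exp ((w * f ω).re)) ∂P ≤
      ENNReal.ofReal (Real.exp (B ^ 2 * ‖w‖ ^ 2 / 2))) {q : ℕ} (hq : 1 ≤ q) :
    ∫⁻ ω, ENNReal.ofReal (‖f ω‖ ^ q) ∂P ≤ ENNReal.ofReal ((16 * B * √q) ^ q) := by
  have hq0 : (0 : ℝ) < q := by exact_mod_cast hq
  -- This choice turns `exp (B ^ 2 * l ^ 2 / 2)` into `exp (q / 2)` and `q / l` into `B * √q`.
  set l : ℝ := √q / B with hl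
  have hl0 : 0 < l := by positivity
  set E := Real.exp (q / 2) with hE
  have hbound : ∀ w : ℂ, ‖w‖ = l →
      ∫⁻ ω, ENNReal.ofReal (Real.exp ((w * f ω).re)) ∂P ≤ ENNReal.ofReal E := by
    intro w hw
    refine (h w).trans_eq ?_
    rw [hw, hE, hl, div_pow, Real.sq_sqrt hq0.le]
    congr 3
    field_simp
  have hm : ∀ w : ℂ, Measurable fun ω => ENNReal.ofReal (Real.exp ((w * f ω).re)) := fun w =>
    (Real.measurable_exp.comp (Complex.measurable_re.comp (hf.const_mul w))).ennreal_ofReal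
  set D := (2 * (q / l)) ^ q with hD
  have hD0 : 0 ≤ D := by positivity
  calc ∫⁻ ω, ENNReal.ofReal (‖f ω‖ ^ q) ∂P
      ≤ ∫⁻ ω, ENNReal.ofReal D * (ENNReal.ofReal (Real.exp (((l : ℂ) * f ω).re)) +
          ENNReal.ofReal (Real.exp (((-l : ℂ) * f ω).re)) +
          (ENNReal.ofReal (Real.exp (((-l * Complex.I : ℂ) * f ω).re)) +
          ENNReal.ofReal (Real.exp (((l * Complex.I : ℂ) * f ω).re)))) ∂P := by
        refine lintegral_mono fun ω => ?_
        rw [← ENNReal.ofReal_add (by positivity) (by positivity),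
          ← ENNReal.ofReal_add (by positivity) (by positivity),
          ← ENNReal.ofReal_add (by positivity) (by positivity), ← ENNReal.ofReal_mul hD0]
        exact ENNReal.ofReal_le_ofReal (norm_pow_le_exp hl0 _ q)
    _ ≤ ENNReal.ofReal D * (ENNReal.ofReal E + ENNReal.ofReal E +
          (ENNReal.ofReal E + ENNReal.ofReal E)) := by
        rw [lintegral_const_mul _ (((hm _).fun_add (hm _)).fun_add ((hm _).fun_add (hm _))),
          lintegral_add_left ((hm _).fun_add (hm _)), lintegral_add_left (hm _),
          lintegral_add_left (hm _)]
        gcongr <;> apply hbound <;> simp [abs_of_pos hl0]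
    _ = ENNReal.ofReal (D * (4 * E)) := by
        have hE0 : 0 ≤ E := (Real.exp_pos _).le
        rw [← ENNReal.ofReal_add hE0 hE0, ← ENNReal.ofReal_add (by positivity) (by positivity),
          ← ENNReal.ofReal_mul hD0]
        congr 2
        ring
    _ ≤ _ := by
        refine ENNReal.ofReal_le_ofReal ?_
        have h1 : D = (2 * B * √q) ^ q := by
          rw [hD, hl]
          congr 1
          field_simp
          rw [Real.sq_sqrt hq0.le]
        have h2 : (4 : ℝ) ≤ 4 ^ q := le_self_pow₀ (by norm_num) (by omega)
        have h3 : E ≤ 2 ^ q := by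
          have : Real.exp (1 / 2) ≤ 2 := by
            have h4 : Real.exp (1 / 2) ^ 2 < 4 := by
              rw [← Real.exp_nat_mul]
              norm_num
              linarith [Real.exp_one_lt_d9]
            nlinarith [Real.exp_pos (1 / 2)]
          calc E = Real.exp (1 / 2) ^ q := by
                rw [hE, ← Real.exp_nat_mul]
                congr 1
                ring
            _ ≤ 2 ^ q := by gcongr
        calc D * (4 * E) ≤ D * (4 ^ q * 2 ^ q) := by gcongr
          _ = _ := by
            rw [h1, ← mul_pow, ← mul_pow]
            congr 1
            ring

/-- Coefficients are complex even when `𝕜 = ℝ`, while `SubgaussianBound` tests only scalars of `𝕜`.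
For real `a` only `re w` matters, so `z` is `re w` or `w` according to the field. -/
lemma exists_re_mul_eq {𝕜 : Type*} [RCLike 𝕜] (w : ℂ) :
    ∃ z : 𝕜, ‖z‖ ≤ ‖w‖ ∧ ∀ a : 𝕜, (w * RCLike.map 𝕜 ℂ a).re = RCLike.re (z * a) := by
  refine ⟨RCLike.map ℂ 𝕜 w, (sq_le_sq₀ (norm_nonneg _) (norm_nonneg _)).mp ?_, fun a => ?_⟩
  · rw [RCLike.norm_sq_eq_def, RCLike.norm_sq_eq_def]
    rcases RCLike.I_eq_zero_or_im_I_eq_one (K := 𝕜) with h | h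
    · simp [RCLike.map_apply, h]
      nlinarith
    · simp [RCLike.map_apply, h]
  · rcases RCLike.I_eq_zero_or_im_I_eq_one (K := 𝕜) with h | h
    · have : RCLike.im a = 0 := by rw [← RCLike.I_im', h]; simp
      simp [RCLike.map_apply, h, this]
    · simp [RCLike.map_apply, h]

lemma measurable_map_rclike {𝕜 : Type*} [RCLike 𝕜] : Measurable (RCLike.map 𝕜 ℂ) :=
  (RCLike.map 𝕜 ℂ).continuous.measurable

lemma norm_map_rclike {𝕜 : Type*} [RCLike 𝕜] (a : 𝕜) : ‖RCLike.map 𝕜 ℂ a‖ = ‖a‖ := by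
  refine (sq_eq_sq₀ (norm_nonneg _) (norm_nonneg _)).mp ?_
  rw [RCLike.norm_sq_eq_def, RCLike.norm_sq_eq_def]
  simp [RCLike.map_apply]

/-- Independent subgaussian variables have subgaussian linear combinations. -/
theorem lintegral_exp_sum_le {𝕜 : Type*} [RCLike 𝕜] {Ω : Type*} [MeasurableSpace Ω]
    {P : Measure Ω} {K : ℕ} {γ : Fin K → Ω → 𝕜} (hind : iIndepFun γ P)
    (hm : ∀ i, Measurable (γ i)) {σ : ℝ} (hσ : ∀ i, SubgaussianBound P (γ i) σ)
    (x : Fin K → ℂ) {B : ℝ} (hB : σ ^ 2 * ∑ i, ‖x i‖ ^ 2 ≤ B ^ 2) (w : ℂ) :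
    ∫⁻ ω, ENNReal.ofReal (Real.exp ((w * ∑ i, RCLike.map 𝕜 ℂ (γ i ω) * x i).re)) ∂P ≤
      ENNReal.ofReal (Real.exp (B ^ 2 * ‖w‖ ^ 2 / 2)) := by
  set g : Fin K → 𝕜 → ℝ≥0∞ := fun i a =>
    ENNReal.ofReal (Real.exp ((w * x i * RCLike.map 𝕜 ℂ a).re)) with hg
  have hgm : ∀ i, Measurable (g i) := fun i =>
    (Real.measurable_exp.comp (Complex.measurable_re.comp
      (measurable_map_rclike.const_mul _))).ennreal_ofReal
  have hprod : ∀ ω, ENNReal.ofReal (Real.exp ((w * ∑ i, RCLike.map 𝕜 ℂ (γ i ω) * x i).re)) =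
      ∏ i, (g i ∘ γ i) ω := fun ω => by
    simp only [hg, Function.comp_apply]
    rw [← ENNReal.ofReal_prod_of_nonneg fun _ _ => (Real.exp_pos _).le, ← Real.exp_sum,
      Finset.mul_sum, Complex.re_sum]
    congr 3
    ext i
    congr 1
    ring
  calc _ = ∏ i, ∫⁻ ω, (g i ∘ γ i) ω ∂P := by
        simp only [hprod]
        exact lintegral_prod_eq_prod_lintegral_of_indepFun Finset.univ _ (hind.comp g hgm)
          fun i => (hgm i).comp (hm i)
    _ ≤ ∏ i, ENNReal.ofReal (Real.exp (σ ^ 2 * (‖w‖ * ‖x i‖) ^ 2 / 2)) := by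
        refine Finset.prod_le_prod' fun i _ => ?_
        obtain ⟨z, hz, hza⟩ := exists_re_mul_eq (𝕜 := 𝕜) (w * x i)
        simp only [hg, Function.comp_apply, hza]
        refine (hσ i z).trans (ENNReal.ofReal_le_ofReal (Real.exp_le_exp.mpr ?_))
        rw [norm_mul] at hz
        gcongr
    _ ≤ _ := by
        rw [← ENNReal.ofReal_prod_of_nonneg fun _ _ => (Real.exp_pos _).le, ← Real.exp_sum]
        refine ENNReal.ofReal_le_ofReal (Real.exp_le_exp.mpr ?_)
        calc ∑ i, σ ^ 2 * (‖w‖ * ‖x i‖) ^ 2 / 2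
            = (σ ^ 2 * ∑ i, ‖x i‖ ^ 2) * ‖w‖ ^ 2 / 2 := by
              rw [Finset.mul_sum, Finset.sum_mul, Finset.sum_div]
              exact Finset.sum_congr rfl fun i _ => by ring
          _ ≤ _ := by gcongr

/-- The strict inequality avoids having to show that the infimum is attained. -/
lemma subgaussianBound_of_sg_lt {𝕜 : Type*} [RCLike 𝕜] {Ω : Type*} [MeasurableSpace Ω]
    {P : Measure Ω} {f : Ω → 𝕜} (hf : IsSubgaussian P f) {σ : ℝ} (h : sg P f < σ) :
    SubgaussianBound P f σ := by
  obtain ⟨-, s₀, hs₀⟩ := hf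
  obtain ⟨s, ⟨hs0, hs⟩, hsσ⟩ := exists_lt_of_csInf_lt ⟨s₀, hs₀⟩ h
  intro z
  refine (hs z).trans (ENNReal.ofReal_le_ofReal (Real.exp_le_exp.mpr ?_))
  gcongr

/-! ### Decreasing rearrangements and the Marcinkiewicz functional. -/

lemma decRearr_set_bddBelow {K : ℕ} (x : Fin K → ℂ) (k : ℕ) :
    BddBelow {t : ℝ | 0 ≤ t ∧ {i : Fin K | t < ‖x i‖}.ncard ≤ k} := ⟨0, fun _ ht => ht.1⟩

lemma sum_norm_mem_decRearr_set {K : ℕ} (x : Fin K → ℂ) (k : ℕ) :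
    ∑ i, ‖x i‖ ∈ {t : ℝ | 0 ≤ t ∧ {i : Fin K | t < ‖x i‖}.ncard ≤ k} := by
  refine ⟨Finset.sum_nonneg fun _ _ => norm_nonneg _, ?_⟩
  have : {i : Fin K | ∑ i, ‖x i‖ < ‖x i‖} = ∅ := Set.eq_empty_of_forall_notMem fun i hi =>
    (Finset.single_le_sum (f := fun i => ‖x i‖) (fun _ _ => norm_nonneg _)
      (Finset.mem_univ i)).not_gt hi
  rw [this]
  simp

lemma decRearr_nonneg {K : ℕ} (x : Fin K → ℂ) (k : ℕ) : 0 ≤ decRearr x k :=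
  Real.sInf_nonneg fun _ ht => ht.1

lemma decRearr_le_sum {K : ℕ} (x : Fin K → ℂ) (k : ℕ) : decRearr x k ≤ ∑ i, ‖x i‖ :=
  csInf_le (decRearr_set_bddBelow x k) (sum_norm_mem_decRearr_set x k)

lemma decRearr_eq_zero {K : ℕ} (x : Fin K → ℂ) {k : ℕ} (hk : K ≤ k) : decRearr x k = 0 := by
  refine le_antisymm (csInf_le (decRearr_set_bddBelow x k) ⟨le_rfl, ?_⟩) (decRearr_nonneg x k)
  refine (Set.ncard_le_ncard (Set.subset_univ _)).trans ?_
  simpa [Set.ncard_univ] using hk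

lemma weakNorm_term_le {K : ℕ} {p : ℝ} (hp : 0 ≤ p) (x : Fin K → ℂ) (k : ℕ) :
    ((k : ℝ) + 1) ^ (1 / p) * decRearr x k ≤ (K : ℝ) ^ (1 / p) * ∑ i, ‖x i‖ := by
  rcases lt_or_ge k K with h | h
  · have : (k : ℝ) + 1 ≤ K := by exact_mod_cast h
    gcongr
    · exact decRearr_nonneg x k
    · exact decRearr_le_sum x k
  · rw [decRearr_eq_zero x h, mul_zero]
    positivity

lemma weakNorm_le {K : ℕ} {p : ℝ} (hp : 0 ≤ p) (x : Fin K → ℂ) :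
    weakNorm p x ≤ (K : ℝ) ^ (1 / p) * ∑ i, ‖x i‖ :=
  ciSup_le fun k => weakNorm_term_le hp x k

lemma le_weakNorm {K : ℕ} {p : ℝ} (hp : 0 ≤ p) (x : Fin K → ℂ) (k : ℕ) :
    ((k : ℝ) + 1) ^ (1 / p) * decRearr x k ≤ weakNorm p x :=
  le_ciSup (f := fun k : ℕ => ((k : ℝ) + 1) ^ (1 / p) * decRearr x k)
    ⟨_, by rintro _ ⟨k, rfl⟩; exact weakNorm_term_le hp x k⟩ k

/-- The entries of `x` can be arranged so as to be dominated by the decreasing rearrangement. -/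
lemma exists_perm_norm_le_decRearr {K : ℕ} (x : Fin K → ℂ) :
    ∃ e : Equiv.Perm (Fin K), ∀ k, ‖x (e k)‖ ≤ decRearr x k := by
  refine ⟨Tuple.sort fun i => -‖x i‖, fun k => ?_⟩
  set e := Tuple.sort fun i => -‖x i‖ with he
  have hmono : Monotone ((fun i => -‖x i‖) ∘ e) := Tuple.monotone_sort _
  refine le_csInf ⟨_, sum_norm_mem_decRearr_set x k⟩ fun t ht => ?_
  by_contra! hlt
  -- Numbering starts at `0`, so `Iic k` has `k + 1` elements, one more than `t` allows.
  have hsub : ((Finset.Iic k).map e.toEmbedding : Set (Fin K)) ⊆ {i | t < ‖x i‖} := by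
    intro i hi
    simp only [Finset.coe_map, Set.mem_image, Finset.coe_Iic, Set.mem_Iic] at hi
    obtain ⟨j, hj, rfl⟩ := hi
    have := hmono hj
    simp only [Function.comp_apply, neg_le_neg_iff] at this
    exact hlt.trans_le this
  have h1 := (Set.ncard_le_ncard hsub).trans ht.2
  rw [Set.ncard_coe_finset, Finset.card_map, Fin.card_Iic] at h1
  omega

lemma exists_perm_norm_le_of_weakNorm_le {K : ℕ} {p : ℝ} (hp : 0 ≤ p) {x : Fin K → ℂ} {A : ℝ}
    (hA : weakNorm p x ≤ A) :
    ∃ e : Equiv.Perm (Fin K), ∀ k, ‖x (e k)‖ ≤ A * ((k : ℕ) + 1 : ℝ) ^ (-(1 / p)) := by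
  obtain ⟨e, he⟩ := exists_perm_norm_le_decRearr x
  refine ⟨e, fun k => (he k).trans ?_⟩
  have hk : (0 : ℝ) < (k : ℕ) + 1 := by positivity
  rw [Real.rpow_neg hk.le, ← div_eq_mul_inv, le_div_iff₀ (by positivity), mul_comm]
  exact (le_weakNorm hp x k).trans hA

/-! ### Power sums, by telescoping in place of integrals. -/

/-- Bernoulli's inequality for exponents in `[0, 1]`; it drives the inductive step of both power
sums. -/
lemma rpow_le_succ_rpow_mul {a : ℝ} (h0 : 0 ≤ a) (h1 : a ≤ 1) (k : ℕ) :
    (k : ℝ) ^ a ≤ ((k : ℝ) + 1) ^ a * (1 - a / (k + 1)) := by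
  have hk : (0 : ℝ) < (k : ℝ) + 1 := by positivity
  have hu : (1 : ℝ) / (k + 1) ≤ 1 := by rw [div_le_one hk]; simp
  have h := rpow_one_add_le_one_add_mul_self (s := -(1 / ((k : ℝ) + 1))) (by linarith) h0 h1
  have h2 : (k : ℝ) = (k + 1) * (1 + -(1 / ((k : ℝ) + 1))) := by field_simp; ring
  calc (k : ℝ) ^ a = ((k : ℝ) + 1) ^ a * (1 + -(1 / ((k : ℝ) + 1))) ^ a := by
        rw [← Real.mul_rpow hk.le (by linarith), ← h2]
    _ ≤ ((k : ℝ) + 1) ^ a * (1 + a * -(1 / ((k : ℝ) + 1))) := by gcongr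
    _ = _ := by ring

lemma sum_range_rpow_sub_one_le {a : ℝ} (h0 : 0 < a) (h1 : a ≤ 1) (q : ℕ) :
    ∑ k ∈ Finset.range q, ((k : ℝ) + 1) ^ (a - 1) ≤ (q : ℝ) ^ a / a := by
  induction q with
  | zero => simp [h0.ne']
  | succ q ih =>
    have hk : (0 : ℝ) < (q : ℝ) + 1 := by positivity
    have h := rpow_le_succ_rpow_mul h0.le h1 q
    have h2 : ((q : ℝ) + 1) ^ (a - 1) = (((q : ℝ) + 1) ^ a * (a / (q + 1))) / a := by
      rw [Real.rpow_sub_one hk.ne']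
      field_simp
    rw [Finset.sum_range_succ, h2]
    push_cast
    calc _ ≤ (q : ℝ) ^ a / a + (((q : ℝ) + 1) ^ a * (a / (q + 1))) / a := by gcongr
      _ = ((q : ℝ) ^ a + ((q : ℝ) + 1) ^ a * (a / (q + 1))) / a := by ring
      _ ≤ _ := by
        gcongr
        linarith

lemma sum_Ico_rpow_le {b : ℝ} (h0 : 0 < b) (h1 : b ≤ 1) {q : ℕ} (hq : 1 ≤ q) (K : ℕ) :
    ∑ k ∈ Finset.Ico q K, ((k : ℝ) + 1) ^ (-1 - b) ≤ (q : ℝ) ^ (-b) / b := by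
  rcases le_total K q with hK | hK
  · rw [Finset.Ico_eq_empty_of_le hK, Finset.sum_empty]
    positivity
  -- The term in `K` makes the bound telescope, so that induction on `K` applies.
  suffices h : ∑ k ∈ Finset.Ico q K, ((k : ℝ) + 1) ^ (-1 - b) ≤
      ((q : ℝ) ^ (-b) - (K : ℝ) ^ (-b)) / b by
    refine h.trans ?_
    gcongr
    have : (0 : ℝ) ≤ (K : ℝ) ^ (-b) := by positivity
    linarith
  induction K, hK using Nat.le_induction with
  | base => simp
  | succ k hk ih =>
    rw [Finset.sum_Ico_succ_top hk]
    have hk0 : (0 : ℝ) < k := by exact_mod_cast (by omega : 0 < k)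
    have hk1 : (0 : ℝ) < (k : ℝ) + 1 := by positivity
    have h := rpow_le_succ_rpow_mul h0.le h1 k
    set y := (k : ℝ) ^ b with hy
    set Y := ((k : ℝ) + 1) ^ b with hY
    have hy0 : 0 < y := by positivity
    have hY0 : 0 < Y := by positivity
    set u := b / ((k : ℝ) + 1) with hu
    have hu0 : 0 < u := by positivity
    -- From `y ≤ Y * (1 - u)` and `(1 + u) * (1 - u) ≤ 1`.
    have h3 : (1 + u) / Y ≤ 1 / y := by
      rw [div_le_div_iff₀ hY0 hy0]
      nlinarith [mul_le_mul_of_nonneg_left h (by positivity : 0 ≤ 1 + u), mul_pos hY0 hu0,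
        mul_pos (mul_pos hY0 hu0) hu0]
    have h4 : ((k : ℝ) + 1) ^ (-1 - b) = (u / Y) / b := by
      rw [show -1 - b = -b - 1 by ring, Real.rpow_sub_one hk1.ne', Real.rpow_neg hk1.le, ← hY, hu]
      field_simp
    push_cast
    rw [Real.rpow_neg hk1.le, ← hY, h4]
    rw [Real.rpow_neg hk0.le, ← hy] at ih
    calc _ ≤ ((q : ℝ) ^ (-b) - y⁻¹) / b + (u / Y) / b := by gcongr
      _ = ((q : ℝ) ^ (-b) - y⁻¹ + u / Y) / b := by ring
      _ ≤ _ := by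
        gcongr
        rw [add_div, one_div, one_div] at h3
        linarith

/-! ### Moments of the random sums at a fixed point. -/

section Moments

variable {𝕜 : Type*} [RCLike 𝕜] {Ω : Type*} [MeasurableSpace Ω] {P : Measure Ω} {K : ℕ}
  {γ : Fin K → Ω → 𝕜}

lemma measurable_sum_map_mul (hm : ∀ i, Measurable (γ i)) (x : Fin K → ℂ) :
    Measurable fun ω => ∑ i, RCLike.map 𝕜 ℂ (γ i ω) * x i :=
  Finset.measurable_fun_sum _ fun i _ => (measurable_map_rclike.comp (hm i)).mul_const _

/-- Moments of a subgaussian sum with coefficients in `ℓ₂`. -/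
theorem lintegral_norm_sum_pow_le (hind : iIndepFun γ P) (hm : ∀ i, Measurable (γ i)) {σ : ℝ}
    (hσ : ∀ i, SubgaussianBound P (γ i) σ) (x : Fin K → ℂ) {B : ℝ} (hB0 : 0 < B)
    (hB : σ ^ 2 * ∑ i, ‖x i‖ ^ 2 ≤ B ^ 2) {q : ℕ} (hq : 1 ≤ q) :
    ∫⁻ ω, ENNReal.ofReal (‖∑ i, RCLike.map 𝕜 ℂ (γ i ω) * x i‖ ^ q) ∂P ≤
      ENNReal.ofReal ((16 * B * √q) ^ q) :=
  lintegral_norm_pow_le_of_exp (measurable_sum_map_mul hm x) hB0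
    (lintegral_exp_sum_le hind hm hσ x hB) hq

/-- Moments of a bounded subgaussian sum with coefficients in a Marcinkiewicz space. -/
theorem lintegral_norm_sum_pow_le_of_weakNorm_le [IsProbabilityMeasure P] (hind : iIndepFun γ P)
    (hm : ∀ i, Measurable (γ i)) {σ M : ℝ} (hσ0 : 0 < σ) (hM0 : 0 ≤ M)
    (hσ : ∀ i, SubgaussianBound P (γ i) σ) (hM : ∀ i, ∀ᵐ ω ∂P, ‖γ i ω‖ ≤ M) {r : ℝ} (hr : 2 < r)
    (x : Fin K → ℂ) {A : ℝ} (hA0 : 0 < A) (hA : weakNorm (r / (r - 1)) x ≤ A) {q : ℕ}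
    (hq : 1 ≤ q) :
    ∫⁻ ω, ENNReal.ofReal (‖∑ i, RCLike.map 𝕜 ℂ (γ i ω) * x i‖ ^ q) ∂P ≤
      ENNReal.ofReal ((2 * (M * r + 16 * σ / √(1 - 2 / r)) * A * (q : ℝ) ^ (1 / r)) ^ q) := by
  have hr0 : 0 < r := by linarith
  have hq0 : (0 : ℝ) < q := by exact_mod_cast hq
  have hb0 : 0 < 1 - 2 / r := by
    rw [sub_pos, div_lt_one hr0]
    exact hr
  have hb1 : 1 - 2 / r ≤ 1 := by
    have : 0 < 2 / r := by positivity
    linarith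
  set b := 1 - 2 / r with hb
  obtain ⟨e, he⟩ := exists_perm_norm_le_of_weakNorm_le
    (div_nonneg hr0.le (by linarith : 0 ≤ r - 1)) hA
  have hexp : -(1 / (r / (r - 1))) = 1 / r - 1 := by
    have : r - 1 ≠ 0 := by linarith
    field_simp
    ring
  rw [hexp] at he
  -- Cutting at rank `q` balances the parts: the head has `ℓ₁` norm at most `A * r * q ^ (1 / r)`,
  -- while the tail has `ℓ₂` norm of order `A * q ^ (1 / r - 1 / 2)`, to be multiplied by the
  -- subgaussian `√q`. The tail is square summable uniformly in `K` because `r > 2`.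
  set x₁ : Fin K → ℂ := fun i => if (e.symm i : ℕ) < q then x i else 0 with hx₁
  set x₂ : Fin K → ℂ := fun i => if (e.symm i : ℕ) < q then 0 else x i with hx₂
  have hsplit : ∀ ω, ∑ i, RCLike.map 𝕜 ℂ (γ i ω) * x i =
      ∑ i, RCLike.map 𝕜 ℂ (γ i ω) * x₁ i + ∑ i, RCLike.map 𝕜 ℂ (γ i ω) * x₂ i := fun ω => by
    rw [← Finset.sum_add_distrib]
    refine Finset.sum_congr rfl fun i _ => ?_
    simp only [hx₁, hx₂]
    split_ifs <;> simp
  have hs₁ : ∑ i, ‖x₁ i‖ ≤ A * (r * (q : ℝ) ^ (1 / r)) := by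
    calc ∑ i, ‖x₁ i‖ = ∑ k, ‖x₁ (e k)‖ := (Equiv.sum_comp e fun i => ‖x₁ i‖).symm
      _ ≤ ∑ k : Fin K, if (k : ℕ) < q then A * ((k : ℕ) + 1 : ℝ) ^ (1 / r - 1) else 0 := by
          refine Finset.sum_le_sum fun k _ => ?_
          simp only [hx₁, Equiv.symm_apply_apply]
          split_ifs
          · exact he k
          · simp
      _ = ∑ k ∈ (Finset.range K).filter (· < q), A * ((k : ℝ) + 1) ^ (1 / r - 1) := by
          rw [Fin.sum_univ_eq_sum_range
            (fun k => if k < q then A * ((k : ℝ) + 1) ^ (1 / r - 1) else 0), Finset.sum_filter]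
      _ ≤ ∑ k ∈ Finset.range q, A * ((k : ℝ) + 1) ^ (1 / r - 1) := by
          refine Finset.sum_le_sum_of_subset_of_nonneg (fun k hk => ?_)
            fun _ _ _ => by positivity
          simpa using (Finset.mem_filter.mp hk).2
      _ ≤ A * ((q : ℝ) ^ (1 / r) / (1 / r)) := by
          rw [← Finset.mul_sum]
          gcongr
          refine sum_range_rpow_sub_one_le (by positivity) ?_ q
          rw [div_le_one hr0]
          linarith
      _ = _ := by rw [div_div_eq_mul_div, div_one, mul_comm r]
  have hs₂ : ∑ i, ‖x₂ i‖ ^ 2 ≤ A ^ 2 * ((q : ℝ) ^ (-b) / b) := by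
    calc ∑ i, ‖x₂ i‖ ^ 2 = ∑ k, ‖x₂ (e k)‖ ^ 2 := (Equiv.sum_comp e fun i => ‖x₂ i‖ ^ 2).symm
      _ ≤ ∑ k : Fin K, if q ≤ (k : ℕ) then A ^ 2 * ((k : ℕ) + 1 : ℝ) ^ (-1 - b) else 0 := by
          refine Finset.sum_le_sum fun k _ => ?_
          simp only [hx₂, Equiv.symm_apply_apply]
          split_ifs with h1 h2 h2
          · omega
          · simp
          · have hk : (0 : ℝ) < (k : ℕ) + 1 := by positivity
            calc ‖x (e k)‖ ^ 2 ≤ (A * ((k : ℕ) + 1 : ℝ) ^ (1 / r - 1)) ^ 2 := by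
                  gcongr
                  exact he k
              _ = _ := by
                  rw [mul_pow, ← Real.rpow_mul_natCast hk.le]
                  congr 2
                  rw [hb]
                  push_cast
                  ring
          · omega
      _ = ∑ k ∈ (Finset.range K).filter (q ≤ ·), A ^ 2 * ((k : ℝ) + 1) ^ (-1 - b) := by
          rw [Fin.sum_univ_eq_sum_range
            (fun k => if q ≤ k then A ^ 2 * ((k : ℝ) + 1) ^ (-1 - b) else 0), Finset.sum_filter]
      _ ≤ ∑ k ∈ Finset.Ico q K, A ^ 2 * ((k : ℝ) + 1) ^ (-1 - b) := by
          refine Finset.sum_le_sum_of_subset_of_nonneg (fun k hk => ?_)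
            fun _ _ _ => by positivity
          rw [Finset.mem_filter, Finset.mem_range] at hk
          exact Finset.mem_Ico.mpr ⟨hk.2, hk.1⟩
      _ ≤ _ := by
          rw [← Finset.mul_sum]
          gcongr
          exact sum_Ico_rpow_le hb0 hb1 hq K
  set Q := (q : ℝ) ^ (1 / r) with hQ
  have hQ0 : 0 < Q := by positivity
  set B := σ * A * Q / (√b * √q) with hB
  have hB0 : 0 < B := by positivity
  have hB2 : σ ^ 2 * ∑ i, ‖x₂ i‖ ^ 2 ≤ B ^ 2 := by
    calc σ ^ 2 * ∑ i, ‖x₂ i‖ ^ 2 ≤ σ ^ 2 * (A ^ 2 * ((q : ℝ) ^ (-b) / b)) := by gcongr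
      _ = B ^ 2 := by
        have h1 : (q : ℝ) ^ (-b) = Q ^ 2 / q := by
          rw [hQ, ← Real.rpow_mul_natCast hq0.le, ← Real.rpow_sub_one hq0.ne']
          congr 1
          rw [hb]
          push_cast
          ring
        rw [hB, div_pow, mul_pow (√b), Real.sq_sqrt hb0.le, Real.sq_sqrt hq0.le, h1]
        field_simp
  have hmom₂ := lintegral_norm_sum_pow_le hind hm hσ x₂ hB0 hB2 hq
  have hBq : 16 * B * √q = 16 * σ / √b * A * Q := by
    rw [hB]
    field_simp
  rw [hBq] at hmom₂
  have hbd₁ : ∀ᵐ ω ∂P, ‖∑ i, RCLike.map 𝕜 ℂ (γ i ω) * x₁ i‖ ≤ M * r * A * Q := by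
    filter_upwards [ae_all_iff.mpr hM] with ω hω
    calc ‖∑ i, RCLike.map 𝕜 ℂ (γ i ω) * x₁ i‖ ≤ ∑ i, M * ‖x₁ i‖ := by
          refine (norm_sum_le _ _).trans (Finset.sum_le_sum fun i _ => ?_)
          rw [norm_mul, norm_map_rclike]
          gcongr
          exact hω i
      _ ≤ M * (A * (r * Q)) := by
          rw [← Finset.mul_sum]
          gcongr
      _ = _ := by ring
  set V := M * r * A * Q with hV
  have hV0 : 0 ≤ V := by positivity
  set U := 16 * σ / √b * A * Q with hU
  have hU0 : 0 ≤ U := by positivity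
  calc _ ≤ ∫⁻ ω, ENNReal.ofReal (2 ^ q) * (ENNReal.ofReal (V ^ q) +
          ENNReal.ofReal (‖∑ i, RCLike.map 𝕜 ℂ (γ i ω) * x₂ i‖ ^ q)) ∂P := by
        refine lintegral_mono_ae ?_
        filter_upwards [hbd₁] with ω hω
        rw [← ENNReal.ofReal_add (by positivity) (by positivity),
          ← ENNReal.ofReal_mul (by positivity), hsplit]
        refine ENNReal.ofReal_le_ofReal ?_
        calc _ ≤ (V + ‖∑ i, RCLike.map 𝕜 ℂ (γ i ω) * x₂ i‖) ^ q := by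
              gcongr
              exact (norm_add_le _ _).trans (by gcongr)
          _ ≤ _ := two_pow_add_pow_le hV0 (norm_nonneg _) q
    _ ≤ ENNReal.ofReal (2 ^ q) * (ENNReal.ofReal (V ^ q) + ENNReal.ofReal (U ^ q)) := by
        rw [lintegral_const_mul' _ _ ENNReal.ofReal_ne_top, lintegral_add_left measurable_const,
          lintegral_const, measure_univ, mul_one]
        gcongr
    _ = ENNReal.ofReal (2 ^ q * (V ^ q + U ^ q)) := by
        rw [← ENNReal.ofReal_add (by positivity) (by positivity),
          ← ENNReal.ofReal_mul (by positivity)]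
    _ ≤ _ := by
        refine ENNReal.ofReal_le_ofReal ?_
        calc 2 ^ q * (V ^ q + U ^ q) ≤ 2 ^ q * (V + U) ^ q := by
              gcongr
              exact pow_add_pow_le hV0 hU0 (by omega)
          _ = _ := by
              rw [← mul_pow, hV, hU]
              congr 1
              ring

end Moments

/-! ### Passage to the supremum and conclusion. -/

/-- This is where `n * (1 + log m)` enters: since `log 4 ≤ 2`, it gives `(4 * m) ^ n ≤ e ^ (2 * q)`.
-/
lemma grid_constant_le {n m q : ℕ} (hm : 1 ≤ m) (hq : (n : ℝ) * (1 + Real.log m) ≤ q) :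
    Real.exp q * (4 * m) ^ n ≤ Real.exp 3 ^ q := by
  have hm0 : (0 : ℝ) < m := by exact_mod_cast hm
  have h4 : Real.log 4 ≤ 2 := by
    rw [show (4 : ℝ) = 2 ^ 2 by norm_num, Real.log_pow]
    have := Real.log_two_lt_d9
    push_cast
    linarith
  have hl : 0 ≤ Real.log m := Real.log_natCast_nonneg m
  rw [← Real.exp_log (by positivity : (0 : ℝ) < 4 * m), ← Real.exp_nat_mul, ← Real.exp_nat_mul,
    ← Real.exp_add, Real.log_mul (by norm_num) hm0.ne']
  refine Real.exp_le_exp.mpr ?_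
  have : (n : ℝ) * (Real.log 4 + Real.log m) ≤ n * (2 * (1 + Real.log m)) := by
    gcongr
    linarith
  linarith

/-- Uniform moment bounds for the values of a random trigonometric polynomial give a bound of its
supremum in an exponential Orlicz space. -/
theorem orliczNorm_randomSup_le {𝕜 : Type*} [RCLike 𝕜] {Ω : Type*} [MeasurableSpace Ω]
    {P : Measure Ω} [IsProbabilityMeasure P] {n m K : ℕ} (hn : 1 ≤ n) (hm : 1 ≤ m)
    {γ : Fin K → Ω → 𝕜} (hγ : ∀ i, Measurable (γ i)) {F : Fin K → (Fin n → Circle) → ℂ}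
    (hF : ∀ i, F i ∈ trigSpace n m) {r T : ℝ} (hr : 1 ≤ r) (hT : 0 < T)
    (hmom : ∀ q : ℕ, 1 ≤ q → ∀ z,
      ∫⁻ ω, ENNReal.ofReal (‖∑ i, RCLike.map 𝕜 ℂ (γ i ω) * F i z‖ ^ q) ∂P ≤
        ENNReal.ofReal ((T * (q : ℝ) ^ (1 / r)) ^ q)) :
    orliczNorm P (expOrlicz r) (randomSup γ F) ≤
      ENNReal.ofReal ((16 * Real.exp 1 * r) ^ (1 / r) *
        ((n : ℝ) * (1 + Real.log m)) ^ (1 / r) * (Real.exp 3 * T)) := by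
  have hn' : (1 : ℝ) ≤ n := by exact_mod_cast hn
  have hl : 0 ≤ Real.log m := Real.log_natCast_nonneg m
  have hX : 1 ≤ (n : ℝ) * (1 + Real.log m) := by nlinarith
  refine orliczNorm_expOrlicz_le hr hX (by positivity)
    (fun ω => Real.iSup_nonneg fun _ => norm_nonneg _) fun q hq => ?_
  have hq1 : 1 ≤ q := by exact_mod_cast hX.trans hq
  obtain ⟨N, hN, hgrid⟩ := exists_grid_norm_pow_le hm n q
  have hN' : (0 : ℝ) < (N : ℝ) ^ n := by positivity
  set S : Ω → (Fin n → Circle) → ℂ := fun ω z => ∑ i, RCLike.map 𝕜 ℂ (γ i ω) * F i z with hS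
  set D := Real.exp q * (4 * (m : ℝ)) ^ n with hD
  have hD0 : 0 ≤ D := by positivity
  have hmeas : ∀ z, Measurable fun ω => ENNReal.ofReal (‖S ω z‖ ^ q) := fun z =>
    ((measurable_sum_map_mul hγ fun i => F i z).norm.pow_const q).ennreal_ofReal
  refine ⟨fun ω => ENNReal.ofReal D * (ENNReal.ofReal ((N : ℝ) ^ n)⁻¹ *
    ∑ k, ENNReal.ofReal (‖S ω (torusGrid n N k)‖ ^ q)), ?_, fun ω => ?_, ?_⟩
  · exact ((Finset.measurable_fun_sum _ fun k _ => hmeas _).const_mul _).const_mul _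
  · have hmem : S ω ∈ trigSpace n m := by
      have : S ω = ∑ i, RCLike.map 𝕜 ℂ (γ i ω) • F i := by
        ext z
        simp [hS]
      rw [this]
      exact Submodule.sum_mem _ fun i _ => Submodule.smul_mem _ _ (hF i)
    beta_reduce
    rw [← ENNReal.ofReal_sum_of_nonneg fun _ _ => by positivity,
      ← ENNReal.ofReal_mul (by positivity), ← ENNReal.ofReal_mul hD0]
    refine ENNReal.ofReal_le_ofReal ?_
    set R := D * (((N : ℝ) ^ n)⁻¹ * ∑ k, ‖S ω (torusGrid n N k)‖ ^ q) with hR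
    have hR0 : 0 ≤ R := by positivity
    have hsup : randomSup γ F ω ≤ R ^ ((q : ℝ)⁻¹) := ciSup_le fun z => by
      rw [← Real.pow_rpow_inv_natCast (norm_nonneg (∑ i, RCLike.map 𝕜 ℂ (γ i ω) * F i z))
        (by omega : q ≠ 0)]
      exact Real.rpow_le_rpow (by positivity) (hgrid _ hmem z) (by positivity)
    calc randomSup γ F ω ^ q ≤ (R ^ ((q : ℝ)⁻¹)) ^ q :=
          pow_le_pow_left₀ (Real.iSup_nonneg fun _ => norm_nonneg _) hsup q
      _ = R := Real.rpow_inv_natCast_pow hR0 (by omega)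
  · rw [lintegral_const_mul' _ _ ENNReal.ofReal_ne_top,
      lintegral_const_mul' _ _ ENNReal.ofReal_ne_top, lintegral_finsetSum _ fun k _ => hmeas _]
    set E := (T * (q : ℝ) ^ (1 / r)) ^ q with hE
    have hE0 : 0 ≤ E := by positivity
    calc _ ≤ ENNReal.ofReal D * (ENNReal.ofReal ((N : ℝ) ^ n)⁻¹ *
          ∑ _k : Fin n → Fin N, ENNReal.ofReal E) := by
          gcongr with k
          exact hmom q hq1 _
      _ = ENNReal.ofReal (D * E) := by
          rw [← ENNReal.ofReal_sum_of_nonneg fun _ _ => hE0, ← ENNReal.ofReal_mul (by positivity),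
            ← ENNReal.ofReal_mul hD0]
          congr 2
          simp only [Finset.sum_const, Finset.card_univ, Fintype.card_fun, Fintype.card_fin,
            nsmul_eq_mul]
          push_cast
          field_simp
      _ ≤ _ := by
          refine ENNReal.ofReal_le_ofReal ?_
          rw [mul_assoc (Real.exp 3), mul_pow (Real.exp 3)]
          exact mul_le_mul_of_nonneg_right (grid_constant_le hm hq) hE0

/-- The moment bounds need a positive scale, but the supremum on the right may vanish; it is
replaced by any larger number. -/
lemma le_ofReal_mul_of_forall_lt {a : ℝ≥0∞} {c A : ℝ}
    (h : ∀ A', A < A' → a ≤ ENNReal.ofReal (c * A')) : a ≤ ENNReal.ofReal (c * A) := by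
  have hcont : Continuous fun t : ℝ => ENNReal.ofReal (c * t) :=
    ENNReal.continuous_ofReal.comp (continuous_const.mul continuous_id)
  refine ge_of_tendsto (hcont.continuousWithinAt (s := Set.Ioi A) (x := A)) ?_
  filter_upwards [self_mem_nhdsWithin] with t ht using h t ht

/-- A real supremum of an unbounded family is `0` by convention, so boundedness is needed before the
supremum can dominate its values. -/
lemma bddAbove_range_of_norm_le {n K : ℕ} {F : Fin K → (Fin n → Circle) → ℂ}
    {c : Fin K → ℝ} (hc : ∀ i z, ‖F i z‖ ≤ c i) {g : (Fin K → ℂ) → ℝ} {a : ℝ} (ha : 0 ≤ a)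
    (hg : ∀ x, g x ≤ a * ∑ i, ‖x i‖) : BddAbove (Set.range fun z => g fun i => F i z) := by
  refine ⟨a * ∑ i, c i, ?_⟩
  rintro _ ⟨z, rfl⟩
  refine (hg _).trans ?_
  gcongr with i
  exact hc i z

lemma l2Norm_le_sum {K : ℕ} (x : Fin K → ℂ) : l2Norm x ≤ 1 * ∑ i, ‖x i‖ := by
  rw [l2Norm, one_mul, Real.sqrt_le_left (Finset.sum_nonneg fun _ _ => norm_nonneg _)]
  exact Finset.sum_sq_le_sq_sum_of_nonneg fun _ _ => norm_nonneg _

end KSZ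

theorem mainTheorem3 :
    (∀ s : ℝ, ∃ C : ℝ, 0 < C ∧
      ∀ (𝕜 : Type*) [RCLike 𝕜] (Ω : Type*) [MeasurableSpace Ω] (P : Measure Ω)
        [IsProbabilityMeasure P] (n m K : ℕ) (γ : Fin K → Ω → 𝕜)
        (F : Fin K → (Fin n → Circle) → ℂ),
        1 ≤ n → 1 ≤ m →
        iIndepFun γ P →
        (∀ i, KSZ.IsSubgaussian P (γ i)) →
        (∀ i, KSZ.sg P (γ i) ≤ s) →
        (∀ i, KSZ.IsTrigPoly m (F i)) →
        KSZ.orliczNorm P (KSZ.expOrlicz 2) (KSZ.randomSup γ F) ≤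
          ENNReal.ofReal (C * ((n : ℝ) * (1 + Real.log m)) ^ ((1 : ℝ) / 2) *
            ⨆ z : Fin n → Circle, KSZ.l2Norm (fun i => F i z))) ∧
    (∀ r : ℝ, 2 < r → ∀ s M : ℝ, ∃ C : ℝ, 0 < C ∧
      ∀ (𝕜 : Type*) [RCLike 𝕜] (Ω : Type*) [MeasurableSpace Ω] (P : Measure Ω)
        [IsProbabilityMeasure P] (n m K : ℕ) (γ : Fin K → Ω → 𝕜)
        (F : Fin K → (Fin n → Circle) → ℂ),
        1 ≤ n → 1 ≤ m →
        iIndepFun γ P →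
        (∀ i, KSZ.IsSubgaussian P (γ i)) →
        (∀ i, KSZ.sg P (γ i) ≤ s) →
        (∀ i, eLpNorm (γ i) ∞ P ≤ ENNReal.ofReal M) →
        (∀ i, KSZ.IsTrigPoly m (F i)) →
        KSZ.orliczNorm P (KSZ.expOrlicz r) (KSZ.randomSup γ F) ≤
          ENNReal.ofReal (C * ((n : ℝ) * (1 + Real.log m)) ^ (1 / r) *
            ⨆ z : Fin n → Circle, KSZ.weakNorm (r / (r - 1)) (fun i => F i z))) := by
  refine ⟨fun s => ?_, fun r hr s M => ?_⟩
  · set σ := |s| + 1 with hσ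
    have hσ0 : 0 < σ := by positivity
    refine ⟨(16 * Real.exp 1 * 2) ^ ((1 : ℝ) / 2) * (Real.exp 3 * (16 * σ)), by positivity, ?_⟩
    intro 𝕜 _ Ω _ P _ n m K γ F hn hm hind hsub hsg hF
    have hmem := fun i => (hF i).mem_trigSpace
    choose c hc using fun i => KSZ.norm_le_of_mem_trigSpace (hmem i)
    have hbdd := KSZ.bddAbove_range_of_norm_le hc zero_le_one KSZ.l2Norm_le_sum
    refine KSZ.le_ofReal_mul_of_forall_lt fun A hA => ?_
    have hA0 : 0 < A := (Real.iSup_nonneg fun _ => Real.sqrt_nonneg _).trans_lt hA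
    have hγ := fun i => (hsub i).1
    refine (KSZ.orliczNorm_randomSup_le hn hm hγ hmem one_le_two
      (T := 16 * (σ * A)) (by positivity) fun q hq z => ?_).trans_eq ?_
    · rw [← Real.sqrt_eq_rpow]
      refine KSZ.lintegral_norm_sum_pow_le hind hγ (σ := σ) (fun i =>
        KSZ.subgaussianBound_of_sg_lt (hsub i) ?_) _ (by positivity) ?_ hq
      · linarith [hsg i, le_abs_self s]
      · rw [mul_pow]
        gcongr
        exact (Real.sqrt_le_left hA0.le).mp ((le_ciSup hbdd z).trans hA.le)
    · congr 1
      ring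
  · set σ := |s| + 1 with hσ
    have hσ0 : 0 < σ := by positivity
    have hr0 : 0 < r := by linarith
    have hb0 : 0 < 1 - 2 / r := by
      rw [sub_pos, div_lt_one hr0]
      exact hr
    -- `M` may be negative; `|M|` keeps `L` positive and still bounds the variables.
    set L := 2 * (|M| * r + 16 * σ / √(1 - 2 / r)) with hL
    have hL0 : 0 < L := by positivity
    refine ⟨(16 * Real.exp 1 * r) ^ (1 / r) * (Real.exp 3 * L), by positivity, ?_⟩
    intro 𝕜 _ Ω _ P _ n m K γ F hn hm hind hsub hsg hM hF
    have hp : 0 ≤ r / (r - 1) := div_nonneg hr0.le (by linarith)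
    have hmem := fun i => (hF i).mem_trigSpace
    choose c hc using fun i => KSZ.norm_le_of_mem_trigSpace (hmem i)
    have hbdd := KSZ.bddAbove_range_of_norm_le hc
      (by positivity : 0 ≤ (K : ℝ) ^ (1 / (r / (r - 1)))) (KSZ.weakNorm_le hp)
    refine KSZ.le_ofReal_mul_of_forall_lt fun A hA => ?_
    have hA0 : 0 < A := (Real.iSup_nonneg fun _ => Real.iSup_nonneg fun _ =>
      mul_nonneg (by positivity) (KSZ.decRearr_nonneg _ _)).trans_lt hA
    have hγ := fun i => (hsub i).1
    refine (KSZ.orliczNorm_randomSup_le hn hm hγ hmem (by linarith)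
      (T := L * A) (by positivity) fun q hq z => ?_).trans_eq ?_
    · refine KSZ.lintegral_norm_sum_pow_le_of_weakNorm_le hind hγ hσ0 (abs_nonneg M) (fun i =>
        KSZ.subgaussianBound_of_sg_lt (hsub i) ?_) (fun i => ?_) hr _ hA0
        ((le_ciSup hbdd z).trans hA.le) hq
      · linarith [hsg i, le_abs_self s]
      · have h := hM i
        rw [eLpNorm_exponent_top] at h
        filter_upwards [ae_le_eLpNormEssSup (f := γ i) (μ := P)] with ω hω
        have h1 := (hω.trans h).trans (ENNReal.ofReal_le_ofReal (le_abs_self M))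
        rwa [← ofReal_norm, ENNReal.ofReal_le_ofReal_iff (abs_nonneg M)] at h1
    · congr 1
      ring
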